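/- **Definitions (Curien's presentation of Girard's ludics).** Addresses are finite words $\xi,\zeta,\dots$ of natural numbers, ramifications are finite sets $I,J\in\mathcal P_f(\omega)$ of natural numbers, and $\xi\star J=\{\xi j\mid j\in J\}$. Two addresses are disjoint if neither is a prefix of the other. Bases have the form $\vdash\Lambda$ or $\xi\vdash\Lambda$, where $\Lambda$ is a finite set of addresses; they are well formed if their addresses are pairwise disjoint. Pseudo-designs are the (possibly infinitely deep) trees of the syntax $$\phi::=\Omega\mid\maltese\mid(+,\xi,I)\cdot\{\psi_{\xi i}\mid i\in I\}\ \text{ (positive)},\qquad \psi_\zeta::=\{(-,\zeta,J)\,\phi_J\mid J\in\mathcal P_f(\omega)\}\ \text{ (negative)}.$$ They are typed (coinductively) by the rules: $\Omega:(\vdash\Lambda)$ and $\maltese:(\vdash\Lambda)$ for $\vdash\Lambda$ well formed; $(+,\xi,I)\cdot\{\psi_{\xi i}\mid i\in I\}:(\vdash\xi,\Lambda)$ if $\vdash\xi,\Lambda$ is well formed and $\psi_{\xi i}:(\xi i\vdash\Lambda_i)$ for all $i\in I$, with pairwise disjoint $\Lambda_i\subseteq\Lambda$; $\{(-,\zeta,J)\phi_J\mid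 J\in\mathcal P_f(\omega)\}:(\zeta\vdash\Lambda)$ if $\zeta\vdash\Lambda$ is well formed and, for all $J$, $\phi_J:(\vdash\zeta\star J,\Lambda_J)$ with $\Lambda_J\subseteq\Lambda$. A design is a typable pseudo-design other than $\Omega$. For $\phi:(\vdash\xi)$ and $\psi:(\xi\vdash)$, write $\phi\perp\psi$ if normalization of $\phi$ against $\psi$ yields $\maltese$, i.e. if the abstract machine with states $\langle\phi\mid\Psi\rangle$ ($\Psi$ a finite set of negative pseudo-designs) and transitions $$\langle(+,\zeta,I)\cdot\Psi'\mid\Psi\rangle\longrightarrow\langle\phi_I\mid\Psi'\cup(\Psi\setminus\{\psi_\zeta\})\rangle\qquad\text{if }\psi_\zeta=\{(-,\zeta,J)\phi_J\mid J\in\mathcal P_f(\omega)\}\in\Psi,$$ started on $\langle\phi\mid\{\psi\}\rangle$, reaches a state $\langle\maltese\mid\Psi\rangle$. For a set $A$ of designs on $\vdash\xi$ (resp. $\xi\vdash$), $A^\perp$ is the set of the designs on $\xi\vdash$ (resp. $\vdash\xi$) that are orthogonal to all the elements of $A$. A positive (resp. negative) behaviour on $\vdash\xi$ (resp. $\xi\vdash$)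 is a set $\mathbf G$ of designs on that base such that $\mathbf G=\mathbf G^{\perp\perp}$. The directory $\mathrm{Dir}(\mathbf G)$ of a positive behaviour $\mathbf G$ is the set of the $I$ such that $(+,\xi,I)\cdot\{\{(-,\xi i,J)\maltese\mid J\in\mathcal P_f(\omega)\}\mid i\in I\}$ belongs to $\mathbf G$. For a set $\mathcal N$ of ramifications, let $\mathit{Dir}_{\mathcal N}=\{(-,\xi,I)\maltese\mid I\in\mathcal N\}\cup\{(-,\xi,I)\Omega\mid I\notin\mathcal N\}$, and let $\mathit{Dai}^-=\{(-,\xi,I)\maltese\mid I\in\mathcal P_f(\omega)\}$. The directory of a negative behaviour $\mathbf G$ is the set $\mathcal N$ such that $\mathit{Dir}_{\mathcal N}$ is the incarnation of $\mathit{Dai}^-$ in $\mathbf G$, that is, the least design of $\mathbf G$ included in $\mathit{Dai}^-$; here $\phi\subseteq\phi'$ means that $\phi'$ is obtained from $\phi$ by replacing some occurrences of $\Omega$ with trees. Two behaviours on the same base are disjoint if their directories are disjoint sets. For disjoint positive behaviours, $\mathbf G\oplus\mathbf H=(\mathbf G\cup\mathbf H)^{\perp\perp}$. **Proposition ($\mathbf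 G\oplus\mathbf H$ is the set union).** Let $\xi$ be an address. 1. If $\mathbf G$ and $\mathbf H$ are disjoint positive behaviours on the base $\vdash\xi$, then $\mathbf G\oplus\mathbf H=\mathbf G\cup\mathbf H$. 2. If $\mathbf G$ and $\mathbf H$ are disjoint negative behaviours on the base $\xi\vdash$, then $(\mathbf G\cap\mathbf H)^\perp=\mathbf G^\perp\cup\mathbf H^\perp$. -/

import Mathlib

namespace Ludics

/-- Addresses are words of natural numbers; the address `ξi` is `ξ ++ [i]`. -/
abbrev Address : Type := List ℕ

/-- A ramification is a finite set of natural numbers (relative addresses). -/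
abbrev Ramification : Type := Finset ℕ

/-- `ξ ⋆ J`, the set of the addresses `ξj` for `j ∈ J`. -/
def star (ξ : Address) (J : Ramification) : Finset Address :=
  J.image fun j => ξ ++ [j]

/-- A finite set of addresses is well formed if no address in it is a prefix of another one. -/
def WellFormed (Λ : Finset Address) : Prop :=
  (Λ : Set Address).Pairwise fun ξ ζ => ¬ ξ <+: ζ

/-- The possible roots of a positive pseudo-design: `Ω`, the daimon, or a positive
action `(+, ξ, I)`. -/
inductive PosRoot : Type
  | omega : PosRoot
  | daimon : PosRoot
  | action (ξ : Address) (I : Ramification) : PosRoot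

/-- The subtrees below a root `(+, ξ, I)` are indexed by the negative actions `(-, ξi, J)`,
with `i ∈ I` and `J` an arbitrary ramification; `Ω` and the daimon are leaves. -/
def PosRoot.Branch : PosRoot → Type
  | .omega => Empty
  | .daimon => Empty
  | .action _ I => {i : ℕ // i ∈ I} × Ramification

/-- The polynomial functor of the syntax of positive pseudo-designs. -/
def posFunctor : PFunctor where
  A := PosRoot
  B := PosRoot.Branch

/-- Positive pseudo-designs: the possibly infinite trees (both in width and in depth) of the syntax
`φ ::= Ω | ✠ | (+, ξ, I) · {ψ_{ξi} | i ∈ I}`. -/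
def PosPseudo : Type := posFunctor.M

/-- Negative pseudo-designs `ψ_ζ = {(-, ζ, J) φ_J | J ∈ P_f(ω)}`, as the family of the `φ_J`.
The focus `ζ` of the initial actions is always given by the place where `ψ` occurs. -/
abbrev NegPseudo : Type := Ramification → PosPseudo

/-- `Ω`, also called the partial design. -/
def omega : PosPseudo := PFunctor.M.mk (F := posFunctor) ⟨.omega, Empty.elim⟩

/-- The daimon `✠`. -/
def daimon : PosPseudo := PFunctor.M.mk (F := posFunctor) ⟨.daimon, Empty.elim⟩

/-- `(+, ξ, I) · {ψ_{ξi} | i ∈ I}`. -/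
def action (ξ : Address) (I : Ramification) (Ψ : {i : ℕ // i ∈ I} → NegPseudo) : PosPseudo :=
  PFunctor.M.mk (F := posFunctor) ⟨.action ξ I, fun p => Ψ p.1 p.2⟩

/-- The rule for `ψ : (ζ ⊢ Λ)`, the judgement `φ : (⊢ Γ)` of the premises being `T φ Γ`. -/
def NegRule (T : PosPseudo → Finset Address → Prop)
    (ψ : NegPseudo) (ζ : Address) (Λ : Finset Address) : Prop :=
  ζ ∉ Λ ∧ WellFormed (insert ζ Λ) ∧ ∀ J : Ramification, ∃ Λ' ⊆ Λ, T (ψ J) (star ζ J ∪ Λ')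

/-- The rules for `φ : (⊢ Γ)`, the judgements of the form `φ' : (⊢ Γ')` on which it rests
being `T φ' Γ'`. -/
def PosRule (T : PosPseudo → Finset Address → Prop)
    (φ : PosPseudo) (Γ : Finset Address) : Prop :=
  WellFormed Γ ∧
    (φ = omega ∨ φ = daimon ∨
      ∃ (ξ : Address) (I : Ramification) (Ψ : {i : ℕ // i ∈ I} → NegPseudo)
        (Λ : Finset Address) (Λs : {i : ℕ // i ∈ I} → Finset Address),
        φ = action ξ I Ψ ∧ ξ ∉ Λ ∧ Γ = insert ξ Λ ∧
        (∀ i, Λs i ⊆ Λ) ∧ (∀ i j, i ≠ j → Disjoint (Λs i) (Λs j)) ∧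
        ∀ i, NegRule T (Ψ i) (ξ ++ [i.1]) (Λs i))

/-- `φ : (⊢ Γ)`. Since designs may have infinite depth, so may typing derivations: this is the
largest relation each instance of which follows from other ones by a typing rule. -/
def PosTyped (φ : PosPseudo) (Γ : Finset Address) : Prop :=
  ∃ T : PosPseudo → Finset Address → Prop, (∀ φ' Γ', T φ' Γ' → PosRule T φ' Γ') ∧ T φ Γ

/-- `ψ : (ζ ⊢ Λ)`. -/
def NegTyped (ψ : NegPseudo) (ζ : Address) (Λ : Finset Address) : Prop :=
  NegRule PosTyped ψ ζ Λ

/-- The designs on the base `⊢ ξ`: typable pseudo-designs other than `Ω`. -/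
def posDesigns (ξ : Address) : Set PosPseudo :=
  {φ | PosTyped φ {ξ} ∧ φ ≠ omega}

/-- The designs on the base `ξ ⊢`. -/
def negDesigns (ξ : Address) : Set NegPseudo :=
  {ψ | NegTyped ψ ξ ∅}

/-- States of the normalization machine: a positive pseudo-design `φ` and a set `Ψ` of negative
ones, `(ζ, ψ) ∈ Ψ` meaning that `Ψ` contains `ψ` as `ψ_ζ`. -/
abbrev State : Type := PosPseudo × Set (Address × NegPseudo)

/-- The reduction rule of the machine: if `Ψ` accepts `ξ`, then
`⟨(+, ξ, I) · Ψ' | Ψ⟩ ⟶ ⟨Ψ_{ξ, I} | Ψ' ∪ (Ψ ∖ ξ)⟩`. -/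
inductive Step : State → State → Prop
  | red (ξ : Address) (I : Ramification) (Ψ' : {i : ℕ // i ∈ I} → NegPseudo)
      (Ψ : Set (Address × NegPseudo)) (ψ : NegPseudo) (h : (ξ, ψ) ∈ Ψ) :
      Step (action ξ I Ψ', Ψ)
        (ψ I, Set.range (fun i : {i : ℕ // i ∈ I} => (ξ ++ [i.1], Ψ' i)) ∪ {p ∈ Ψ | p.1 ≠ ξ})

/-- The orthogonality `φ ⊥ ψ` of `φ : (⊢ ξ)` and `ψ : (ξ ⊢)`: the normal form of the closed net
`⟨φ | {ψ}⟩` is the daimon, that is, the machine started on it stops on the daimon. -/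
def Orthogonal (ξ : Address) (φ : PosPseudo) (ψ : NegPseudo) : Prop :=
  ∃ Ψ : Set (Address × NegPseudo), Relation.ReflTransGen Step (φ, {(ξ, ψ)}) (daimon, Ψ)

/-- `A^⊥` for a set `A` of designs on the base `⊢ ξ`. -/
def posOrth (ξ : Address) (A : Set PosPseudo) : Set NegPseudo :=
  {ψ ∈ negDesigns ξ | ∀ φ ∈ A, Orthogonal ξ φ ψ}

/-- `A^⊥` for a set `A` of designs on the base `ξ ⊢`. -/
def negOrth (ξ : Address) (A : Set NegPseudo) : Set PosPseudo :=
  {φ ∈ posDesigns ξ | ∀ ψ ∈ A, Orthogonal ξ φ ψ}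

/-- Positive behaviours on the base `⊢ ξ`. -/
def IsPosBehaviour (ξ : Address) (G : Set PosPseudo) : Prop :=
  G ⊆ posDesigns ξ ∧ G = negOrth ξ (posOrth ξ G)

/-- Negative behaviours on the base `ξ ⊢`. -/
def IsNegBehaviour (ξ : Address) (G : Set NegPseudo) : Prop :=
  G ⊆ negDesigns ξ ∧ G = posOrth ξ (negOrth ξ G)

/-- `Ram_(ξ,I)`, whose root is `(+, ξ, I)` and whose other positive nodes are daimons. -/
def ram (ξ : Address) (I : Ramification) : PosPseudo :=
  action ξ I fun _ _ => daimon

/-- `Dai⁻`, which answers the daimon to every initial action. -/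
def daiNeg : NegPseudo := fun _ => daimon

open Classical in
/-- `Dir_N`, which answers the daimon to the initial actions with ramification in `N`, and `Ω` to
the other ones. -/
noncomputable def dirDesign (N : Set Ramification) : NegPseudo :=
  fun I => if I ∈ N then daimon else omega

/-- The stable order `φ₁ ⊆ φ₂`: `φ₂` is obtained from `φ₁` by replacing some `Ω`'s with trees
(coinductively, since trees may be infinite). -/
def PosStable (φ₁ φ₂ : PosPseudo) : Prop :=
  ∃ R : PosPseudo → PosPseudo → Prop,
    (∀ φ φ', R φ φ' →
      φ = omega ∨ (φ = daimon ∧ φ' = daimon) ∨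
        ∃ (ξ : Address) (I : Ramification) (Ψ Ψ' : {i : ℕ // i ∈ I} → NegPseudo),
          φ = action ξ I Ψ ∧ φ' = action ξ I Ψ' ∧ ∀ i J, R (Ψ i J) (Ψ' i J)) ∧
    R φ₁ φ₂

/-- The stable order on negative pseudo-designs. -/
def NegStable (ψ₁ ψ₂ : NegPseudo) : Prop :=
  ∀ J : Ramification, PosStable (ψ₁ J) (ψ₂ J)

/-- `ψ'` is the incarnation `|ψ|_G` of `ψ` in the negative behaviour `G`, the least design of `G`
that is included in `ψ`. -/
def IsIncarnation (G : Set NegPseudo) (ψ ψ' : NegPseudo) : Prop :=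
  ψ' ∈ G ∧ NegStable ψ' ψ ∧ ∀ ψ'' ∈ G, NegStable ψ'' ψ → NegStable ψ' ψ''

/-- The directory of a positive behaviour on the base `⊢ ξ`. -/
def posDirectory (ξ : Address) (G : Set PosPseudo) : Set Ramification :=
  {I | ram ξ I ∈ G}

/-- The directory of a negative behaviour, the set `N` for which `Dir_N` is the incarnation of
`Dai⁻` in `G`. -/
def negDirectory (G : Set NegPseudo) : Set Ramification :=
  {I | ∃ N : Set Ramification, IsIncarnation G daiNeg (dirDesign N) ∧ I ∈ N}

/-- `G ⊕ H = (G ∪ H)^⊥⊥`. -/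
def oplus (ξ : Address) (G H : Set PosPseudo) : Set PosPseudo :=
  negOrth ξ (posOrth ξ (G ∪ H))

end Ludics

/-! Against `ψ`, a design with root `(+, ξ, I)` consumes `ψ` in its first step and only ever sees
the branch `ψ I` (`orthogonal_action_iff`). So, to test such a design, every other branch of `ψ` may
be overwritten with the daimon, which makes `ψ` orthogonal to all designs with another ramification.
If `I` is not in the directory of `H`, then no design of `H` starts with `I`
(`IsPosBehaviour.mem_posDirectory`), and the overwritten `ψ ∈ G^⊥` lies in `(G ∪ H)^⊥`. Hence a
design of `G ⊕ H` with ramification `I` is orthogonal to all of `G^⊥`, so it lies in `G`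
(`mem_of_mem_oplus`).

The second part is the first one applied to `G^⊥` and `H^⊥`, once their directories are compared
with those of `G` and `H` (`isIncarnation_dirDesign`). -/

namespace Ludics

/-! ### Roots of positive pseudo-designs -/

lemma action_ne_daimon (ξ : Address) (I : Ramification) (Ψ : {i : ℕ // i ∈ I} → NegPseudo) :
    action ξ I Ψ ≠ daimon := by
  intro h
  have h' := congrArg (fun x => (PFunctor.M.dest (F := posFunctor) x).1) h
  exact PosRoot.noConfusion h'

lemma action_ne_omega (ξ : Address) (I : Ramification) (Ψ : {i : ℕ // i ∈ I} → NegPseudo) :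
    action ξ I Ψ ≠ omega := by
  intro h
  have h' := congrArg (fun x => (PFunctor.M.dest (F := posFunctor) x).1) h
  exact PosRoot.noConfusion h'

lemma omega_ne_daimon : omega ≠ daimon := by
  intro h
  have h' := congrArg (fun x => (PFunctor.M.dest (F := posFunctor) x).1) h
  exact PosRoot.noConfusion h'

lemma action_inj_root {ξ ζ : Address} {I J : Ramification} {Ψ : {i : ℕ // i ∈ I} → NegPseudo}
    {Ψ' : {i : ℕ // i ∈ J} → NegPseudo} (h : action ξ I Ψ = action ζ J Ψ') :
    ξ = ζ ∧ I = J := by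
  have h' := congrArg (fun x => (PFunctor.M.dest (F := posFunctor) x).1) h
  exact PosRoot.action.inj h'

lemma action_inj {ξ : Address} {I : Ramification} {Ψ Ψ' : {i : ℕ // i ∈ I} → NegPseudo}
    (h : action ξ I Ψ = action ξ I Ψ') : Ψ = Ψ' := by
  have h₁ := PFunctor.M.mk_inj (F := posFunctor) h
  have h₂ := eq_of_heq (Sigma.mk.inj h₁).2
  funext i J
  exact congrFun h₂ (i, J)

/-! ### Reduction -/

/-- Every step from a state whose root is `(+, ξ, I)` uses some `ψ` that the state holds at `ξ`. -/
lemma step_action_iff {ξ : Address} {I : Ramification} {Ψ' : {i : ℕ // i ∈ I} → NegPseudo}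
    {Ψ : Set (Address × NegPseudo)} {s : State} :
    Step (action ξ I Ψ', Ψ) s ↔ ∃ ψ, (ξ, ψ) ∈ Ψ ∧ s = (ψ I,
      Set.range (fun i : {i : ℕ // i ∈ I} => (ξ ++ [i.1], Ψ' i)) ∪ {p ∈ Ψ | p.1 ≠ ξ}) := by
  constructor
  · intro h
    generalize hs : (action ξ I Ψ', Ψ) = t at h
    cases h with
    | red ζ J Ψ₁ Ψ₂ ψ hψ =>
      obtain ⟨h₁, rfl⟩ := Prod.mk.inj hs
      obtain ⟨rfl, rfl⟩ := action_inj_root h₁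
      cases action_inj h₁
      exact ⟨ψ, hψ, rfl⟩
  · rintro ⟨ψ, hψ, rfl⟩
    exact Step.red ξ I Ψ' Ψ ψ hψ

/-- The normalization of a state yields the daimon. -/
def Converges (s : State) : Prop :=
  ∃ Ψ : Set (Address × NegPseudo), Relation.ReflTransGen Step s (daimon, Ψ)

lemma converges_daimon (Ψ : Set (Address × NegPseudo)) : Converges (daimon, Ψ) :=
  ⟨Ψ, .refl⟩

lemma not_converges_omega (Ψ : Set (Address × NegPseudo)) : ¬ Converges (omega, Ψ) := by
  rintro ⟨Ψ', h⟩
  rcases Relation.ReflTransGen.cases_head h with h | ⟨s, h, -⟩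
  · exact omega_ne_daimon (Prod.mk.inj h).1
  · generalize hs : (omega, Ψ) = t at h
    cases h
    exact action_ne_omega _ _ _ (Prod.mk.inj hs).1.symm

/-- Normalization to the daimon is preserved when negative components are replaced with `Dai⁻`. -/
lemma Converges.mono_daiNeg {φ : PosPseudo} {Ψ Ψ' : Set (Address × NegPseudo)}
    (h : Converges (φ, Ψ)) (hΨ : ∀ p ∈ Ψ, p ∈ Ψ' ∨ (p.1, daiNeg) ∈ Ψ') :
    Converges (φ, Ψ') := by
  obtain ⟨Ψ₀, h⟩ := h
  generalize hs : (φ, Ψ) = s at h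
  induction h using Relation.ReflTransGen.head_induction_on generalizing φ Ψ Ψ' with
  | refl =>
    obtain ⟨rfl, -⟩ := Prod.mk.inj hs
    exact converges_daimon _
  | head hstep _ ih =>
    cases hstep with
    | red ξ I Ψ₁ Ψ₂ ψ hψ =>
      obtain ⟨rfl, rfl⟩ := Prod.mk.inj hs
      rcases hΨ _ hψ with hmem | hmem
      -- Both nets can use the same `ψ`, and the hypothesis relating their contexts survives the
      -- step.
      · obtain ⟨Ψ₃, h₃⟩ := ih (Ψ' := Set.range
            (fun i : {i : ℕ // i ∈ I} => (ξ ++ [i.1], Ψ₁ i)) ∪ {p ∈ Ψ' | p.1 ≠ ξ}) (by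
          rintro p (hp | ⟨hp, hpξ⟩)
          · exact .inl (.inl hp)
          · exact (hΨ p hp).imp (fun h => .inr ⟨h, hpξ⟩) (fun h => .inr ⟨h, hpξ⟩)) rfl
        exact ⟨Ψ₃, .head (Step.red ξ I Ψ₁ Ψ' ψ hmem) h₃⟩
      -- Once `Dai⁻` is selected, the run ends on the daimon at once.
      · exact ⟨_, .single (Step.red ξ I Ψ₁ Ψ' daiNeg hmem)⟩

/-! ### Orthogonality -/

lemma orthogonal_daimon (ξ : Address) (ψ : NegPseudo) : Orthogonal ξ daimon ψ :=
  converges_daimon _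

lemma orthogonal_action_iff {ξ : Address} {I : Ramification}
    {Ψ : {i : ℕ // i ∈ I} → NegPseudo} {ψ : NegPseudo} :
    Orthogonal ξ (action ξ I Ψ) ψ ↔
      Converges (ψ I, Set.range fun i : {i : ℕ // i ∈ I} => (ξ ++ [i.1], Ψ i)) := by
  have hempty : {p ∈ ({(ξ, ψ)} : Set (Address × NegPseudo)) | p.1 ≠ ξ} = ∅ := by
    ext p
    simp only [Set.mem_ofPred_eq, Set.mem_singleton_iff, Set.mem_empty_iff_false, iff_false]
    rintro ⟨rfl, h⟩
    exact h rfl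
  constructor
  · rintro ⟨Ψ', h⟩
    rcases Relation.ReflTransGen.cases_head h with h | ⟨s, hs, h⟩
    · exact absurd (Prod.mk.inj h).1 (action_ne_daimon _ _ _)
    · obtain ⟨ψ', hψ', rfl⟩ := step_action_iff.1 hs
      obtain rfl : ψ' = ψ := (Prod.mk.inj hψ').2
      rw [hempty, Set.union_empty] at h
      exact ⟨Ψ', h⟩
  · rintro ⟨Ψ', h⟩
    refine ⟨Ψ', .head (step_action_iff.2 ⟨ψ, rfl, rfl⟩) ?_⟩
    rwa [hempty, Set.union_empty]

lemma orthogonal_action_of_eq_daimon {ξ : Address} {I : Ramification}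
    {Ψ : {i : ℕ // i ∈ I} → NegPseudo} {ψ : NegPseudo} (h : ψ I = daimon) :
    Orthogonal ξ (action ξ I Ψ) ψ :=
  orthogonal_action_iff.2 (h ▸ converges_daimon _)

/-- The subtrees of `ram ξ I` are copies of `Dai⁻`, and these can only make normalization reach the
daimon sooner. -/
lemma Orthogonal.ram {ξ : Address} {I : Ramification} {Ψ : {i : ℕ // i ∈ I} → NegPseudo}
    {ψ : NegPseudo} (h : Orthogonal ξ (action ξ I Ψ) ψ) : Orthogonal ξ (ram ξ I) ψ := by
  refine orthogonal_action_iff.2 ((orthogonal_action_iff.1 h).mono_daiNeg ?_)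
  rintro _ ⟨i, rfl⟩
  exact .inr ⟨i, rfl⟩

/-! ### Typing -/

lemma wellFormed_singleton (ξ : Address) : WellFormed {ξ} := by
  simp [WellFormed]

lemma wellFormed_star (ξ : Address) (J : Ramification) : WellFormed (star ξ J) := by
  intro a ha b hb hab hpre
  simp only [star, Finset.coe_image, Set.mem_image] at ha hb
  obtain ⟨i, -, rfl⟩ := ha
  obtain ⟨j, -, rfl⟩ := hb
  exact hab (hpre.eq_of_length (by simp))

lemma posTyped_omega {Γ : Finset Address} (hΓ : WellFormed Γ) : PosTyped omega Γ :=
  ⟨fun φ Γ' => φ = omega ∧ WellFormed Γ', fun _ _ h => ⟨h.2, .inl h.1⟩, rfl, hΓ⟩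

lemma posTyped_daimon {Γ : Finset Address} (hΓ : WellFormed Γ) : PosTyped daimon Γ :=
  ⟨fun φ Γ' => φ = daimon ∧ WellFormed Γ', fun _ _ h => ⟨h.2, .inr (.inl h.1)⟩, rfl, hΓ⟩

lemma negTyped_empty_iff {ψ : NegPseudo} {ξ : Address} :
    NegTyped ψ ξ ∅ ↔ ∀ J, PosTyped (ψ J) (star ξ J) := by
  simp [NegTyped, NegRule, wellFormed_singleton]

lemma ram_mem_posDesigns (ξ : Address) (I : Ramification) : ram ξ I ∈ posDesigns ξ := by
  -- The relation consists of all that a derivation for `ram ξ I` uses: its conclusion and the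
  -- daimon axioms.
  refine ⟨⟨fun φ Γ => (φ = daimon ∧ WellFormed Γ) ∨ (φ = ram ξ I ∧ Γ = {ξ}), ?_,
    .inr ⟨rfl, rfl⟩⟩, action_ne_omega _ _ _⟩
  rintro φ Γ (⟨rfl, hΓ⟩ | ⟨rfl, rfl⟩)
  · exact ⟨hΓ, .inr (.inl rfl)⟩
  · refine ⟨wellFormed_singleton ξ, .inr (.inr ⟨ξ, I, _, ∅, fun _ => ∅, rfl, by simp, by simp,
      by simp, by simp, fun i => ⟨by simp, wellFormed_singleton _, fun J => ⟨∅, by simp, .inl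
      ⟨rfl, ?_⟩⟩⟩⟩)⟩
    rw [Finset.union_empty]
    exact wellFormed_star _ _

lemma eq_daimon_or_eq_action {ξ : Address} {φ : PosPseudo} (h : φ ∈ posDesigns ξ) :
    φ = daimon ∨ ∃ I Ψ, φ = action ξ I Ψ := by
  obtain ⟨⟨T, hT, hφ⟩, hne⟩ := h
  obtain ⟨-, h | h | ⟨ζ, I, Ψ, Λ, -, rfl, -, hΓ, -⟩⟩ := hT _ _ hφ
  · exact absurd h hne
  · exact .inl h
  · obtain rfl : ζ = ξ := Finset.mem_singleton.1 (hΓ ▸ Finset.mem_insert_self ζ Λ)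
    exact .inr ⟨I, Ψ, rfl⟩

/-! ### Behaviours and directories -/

lemma posOrth_union (ξ : Address) (A B : Set PosPseudo) :
    posOrth ξ (A ∪ B) = posOrth ξ A ∩ posOrth ξ B := by
  ext ψ
  constructor
  · rintro ⟨h, h'⟩
    exact ⟨⟨h, fun φ hφ => h' φ (.inl hφ)⟩, h, fun φ hφ => h' φ (.inr hφ)⟩
  · rintro ⟨⟨h, h₁⟩, -, h₂⟩
    exact ⟨h, fun φ hφ => hφ.elim (h₁ φ) (h₂ φ)⟩

lemma IsNegBehaviour.isPosBehaviour_negOrth {ξ : Address} {G : Set NegPseudo}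
    (hG : IsNegBehaviour ξ G) : IsPosBehaviour ξ (negOrth ξ G) :=
  ⟨fun _ h => h.1, congrArg (negOrth ξ) hG.2⟩

/-- A set of designs of the form `A^⊥` contains `Ram_(ξ,I)` as soon as it contains a design with
root `(+, ξ, I)`. -/
lemma ram_mem_negOrth {ξ : Address} {A : Set NegPseudo} {I : Ramification}
    {Ψ : {i : ℕ // i ∈ I} → NegPseudo} (h : action ξ I Ψ ∈ negOrth ξ A) :
    ram ξ I ∈ negOrth ξ A :=
  ⟨ram_mem_posDesigns ξ I, fun ψ hψ => (h.2 ψ hψ).ram⟩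

lemma IsPosBehaviour.mem_posDirectory {ξ : Address} {G : Set PosPseudo}
    (hG : IsPosBehaviour ξ G) {I : Ramification} {Ψ : {i : ℕ // i ∈ I} → NegPseudo}
    (h : action ξ I Ψ ∈ G) : I ∈ posDirectory ξ G := by
  have h' := h
  rw [hG.2] at h'
  have := ram_mem_negOrth h'
  rwa [← hG.2] at this

/-- Restricting the answers of `ψ ∈ G^⊥` to a single `I`, with the daimon elsewhere, yields
a design that is orthogonal to `G` and to every behaviour without `I` in its directory. -/
lemma mem_of_mem_oplus {ξ : Address} {G H : Set PosPseudo} (hG : IsPosBehaviour ξ G)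
    (hH : IsPosBehaviour ξ H) {I : Ramification} {Ψ : {i : ℕ // i ∈ I} → NegPseudo}
    (hI : I ∉ posDirectory ξ H) (h : action ξ I Ψ ∈ oplus ξ G H) : action ξ I Ψ ∈ G := by
  rw [hG.2]
  refine ⟨h.1, fun ψ hψ => ?_⟩
  set ψ' : NegPseudo := Function.update daiNeg I (ψ I) with hψ'
  have hI' : ψ' I = ψ I := by simp [hψ']
  have hne : ∀ J, J ≠ I → ψ' J = daimon := fun J hJ => by simp [hψ', hJ, daiNeg]
  have hdesign : ψ' ∈ negDesigns ξ := by
    refine negTyped_empty_iff.2 fun J => ?_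
    by_cases hJ : J = I
    · subst hJ
      rw [hI']
      exact negTyped_empty_iff.1 hψ.1 J
    · rw [hne J hJ]
      exact posTyped_daimon (wellFormed_star ξ J)
  have horth : ψ' ∈ posOrth ξ (G ∪ H) := by
    refine ⟨hdesign, fun φ hφ => ?_⟩
    rcases eq_daimon_or_eq_action (hφ.elim (fun h => hG.1 h) (fun h => hH.1 h)) with
      rfl | ⟨J, Ψ', rfl⟩
    · exact orthogonal_daimon ξ ψ'
    · by_cases hJ : J = I
      · subst hJ
        rcases hφ with hφ | hφ
        · rw [orthogonal_action_iff, hI', ← orthogonal_action_iff]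
          exact hψ.2 _ hφ
        · exact absurd (hH.mem_posDirectory hφ) hI
      · exact orthogonal_action_of_eq_daimon (hne J hJ)
  -- Only the branch at `I` is visited, where `ψ'` and `ψ` agree.
  have := h.2 ψ' horth
  rwa [orthogonal_action_iff, hI', ← orthogonal_action_iff] at this

theorem oplus_eq_union {ξ : Address} {G H : Set PosPseudo} (hG : IsPosBehaviour ξ G)
    (hH : IsPosBehaviour ξ H) (hd : Disjoint (posDirectory ξ G) (posDirectory ξ H)) :
    oplus ξ G H = G ∪ H := by
  apply Set.Subset.antisymm
  · intro φ hφ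
    rcases eq_daimon_or_eq_action hφ.1 with rfl | ⟨I, Ψ, rfl⟩
    -- The daimon lies in every positive behaviour, so either side would do.
    · left
      rw [hG.2]
      exact ⟨hφ.1, fun ψ _ => orthogonal_daimon ξ ψ⟩
    -- By disjointness `I` is missing from at least one directory; the design then belongs to the
    -- other behaviour.
    · by_cases hI : I ∈ posDirectory ξ H
      · refine .inr (mem_of_mem_oplus hH hG (Set.disjoint_right.1 hd hI) ?_)
        rwa [oplus, Set.union_comm]
      · exact .inl (mem_of_mem_oplus hG hH hI hφ)
  · exact fun φ hφ => ⟨hφ.elim (fun h => hG.1 h) (fun h => hH.1 h), fun ψ hψ => hψ.2 φ hφ⟩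

/-- In a negative behaviour `G`, the incarnation of `Dai⁻` is `Dir_N` for the directory `N`
of `G^⊥`. -/
lemma isIncarnation_dirDesign {ξ : Address} {G : Set NegPseudo} (hG : IsNegBehaviour ξ G) :
    IsIncarnation G daiNeg (dirDesign (posDirectory ξ (negOrth ξ G))) := by
  refine ⟨?_, fun J => ?_, fun ψ hψ hstable J => ?_⟩
  · rw [hG.2]
    refine ⟨negTyped_empty_iff.2 fun J => ?_, fun φ hφ => ?_⟩
    · unfold dirDesign
      split_ifs
      · exact posTyped_daimon (wellFormed_star ξ J)
      · exact posTyped_omega (wellFormed_star ξ J)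
    · rw [← hG.2]
      rcases eq_daimon_or_eq_action hφ.1 with rfl | ⟨I, Ψ, rfl⟩
      · exact orthogonal_daimon ξ _
      · exact orthogonal_action_of_eq_daimon
          (if_pos (show ram ξ I ∈ negOrth ξ G from ram_mem_negOrth hφ))
  · refine ⟨fun φ φ' => φ = omega ∨ φ = daimon ∧ φ' = daimon,
      fun φ φ' h => h.imp_right .inl, ?_⟩
    unfold dirDesign
    split_ifs
    · exact .inr ⟨rfl, rfl⟩
    · exact .inl rfl
  · by_cases hJ : J ∈ posDirectory ξ (negOrth ξ G)
    -- Being below `Dai⁻`, `ψ J` is `Ω` or the daimon. It is not `Ω`, since `ψ` must be orthogonal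
    -- to `ram ξ J ∈ G^⊥`.
    · have hψJ : ψ J = daimon := by
        obtain ⟨R, hR, hJR⟩ := hstable J
        rcases hR _ _ hJR with h | ⟨h, -⟩ | ⟨_, _, _, _, _, h, -⟩
        · have := orthogonal_action_iff.1 (hJ.2 ψ hψ)
          rw [h] at this
          exact absurd this (not_converges_omega _)
        · exact h
        · exact absurd h.symm (action_ne_daimon _ _ _)
      rw [hψJ, dirDesign, if_pos hJ]
      exact ⟨fun φ φ' => φ = daimon ∧ φ' = daimon, fun _ _ h => .inr (.inl h), rfl, rfl⟩
    · rw [dirDesign, if_neg hJ]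
      exact ⟨fun φ _ => φ = omega, fun _ _ h => .inl h, rfl⟩

/-- This inclusion suffices, as disjointness passes to subsets. -/
lemma posDirectory_negOrth_subset {ξ : Address} {G : Set NegPseudo} (hG : IsNegBehaviour ξ G) :
    posDirectory ξ (negOrth ξ G) ⊆ negDirectory G :=
  fun _ hI => ⟨_, isIncarnation_dirDesign hG, hI⟩

/-- Since `G = G^⊥⊥` and `H = H^⊥⊥`, the intersection is `(G^⊥ ∪ H^⊥)^⊥`, and its orthogonal is `G^⊥
⊕ H^⊥`. -/
theorem negOrth_inter_eq_union {ξ : Address} {G H : Set NegPseudo} (hG : IsNegBehaviour ξ G)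
    (hH : IsNegBehaviour ξ H) (hd : Disjoint (negDirectory G) (negDirectory H)) :
    negOrth ξ (G ∩ H) = negOrth ξ G ∪ negOrth ξ H := by
  rw [← oplus_eq_union hG.isPosBehaviour_negOrth hH.isPosBehaviour_negOrth
    (hd.mono (posDirectory_negOrth_subset hG) (posDirectory_negOrth_subset hH)), oplus,
    posOrth_union, ← hG.2, ← hH.2]

end Ludics

theorem mainTheorem12 (ξ : Ludics.Address) :
    (∀ G H : Set Ludics.PosPseudo,
      Ludics.IsPosBehaviour ξ G → Ludics.IsPosBehaviour ξ H →
      Disjoint (Ludics.posDirectory ξ G) (Ludics.posDirectory ξ H) →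
      Ludics.oplus ξ G H = G ∪ H) ∧
    (∀ G H : Set Ludics.NegPseudo,
      Ludics.IsNegBehaviour ξ G → Ludics.IsNegBehaviour ξ H →
      Disjoint (Ludics.negDirectory G) (Ludics.negDirectory H) →
      Ludics.negOrth ξ (G ∩ H) = Ludics.negOrth ξ G ∪ Ludics.negOrth ξ H) :=
  ⟨fun _ _ => Ludics.oplus_eq_union, fun _ _ => Ludics.negOrth_inter_eq_union⟩
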